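/- Let $g:[0,\infty)\to\mathbb{R}$ be a convex and Lipschitz continuous payoff function and let $S_0>0$ be the initial price of an asset. For uncertainty sets $\mathcal U_1,\dots,\mathcal U_\tau\subset\mathbb{R}$, consider the $\tau$-round hedging game: in each round $t=1,\dots,\tau$ the trader, knowing the past returns $R_1,\dots,R_{t-1}$, chooses a dollar amount $\Delta_t\in\mathbb{R}$ of the asset to hold, and then nature chooses a return $R_t\in\mathcal U_t$. The upper bound of the price of the European option with payoff $g$ is $$ \inf_{\Delta_1,\dots,\Delta_\tau}\ \sup_{R_t\in\mathcal U_t,\ 1\le t\le\tau}\ \Big\{ g\Big(S_0\prod_{t=1}^{\tau}(1+R_t)\Big)-\sum_{t=1}^{\tau}R_t\Delta_t\Big\}, $$ the infimum being over all adaptive strategies $\Delta_t=\Delta_t(R_1,\dots,R_{t-1})$. For every $\tau\ge 1$ and $1\le t\le \tau$ let $\mathcal U_t^\tau=[-\underline\zeta_t^\tau,\overline\zeta_t^\tau]$ with $\underline\zeta_t^\tau,\overline\zeta_t^\tau\ge 0$. Suppose that $$ \lim_{\tau\to\infty}\sum_{t=1}^{\tau}\underline\zeta_t^\tau\,\overline\zeta_t^\tau=\nu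 \quad\text{for some } \nu>0, \qquad \lim_{\tau\to\infty}\ \sup_{1\le t\le\tau}\max\{\underline\zeta_t^\tau,\overline\zeta_t^\tau\}=0 . $$ (For the finitely many $\tau$ for which some $\underline\zeta_t^\tau>1$, extend $g$ arbitrarily to negative prices.) Then, as $\tau\to\infty$, the upper bound of the option price in the $\tau$-round game with uncertainty sets $\mathcal U_1^\tau,\dots,\mathcal U_\tau^\tau$ converges to $$ \mathbb{E}\Big[g\big(S_0\exp\{\sqrt{\nu}\,Z-\nu/2\}\big)\Big],\qquad Z\sim N(0,1), $$ this expectation being well defined and finite. The limit is the option price for a geometric Brownian motion with zero drift: if $W$ is a standard Brownian motion, $\sigma>0$, $T\ge 0$ and $\sigma^2T=\nu$, then $g(S_T)$ is integrable and the limit equals $\mathbb{E}[g(S_T)]$ for $S_t=S_0\exp\{\sigma W_t-\sigma^2t/2\}$. -/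

import Mathlib

open MeasureTheory ProbabilityTheory Filter Topology
open scoped NNReal

noncomputable section

/-- An adaptive hedging strategy of the trader in the `τ`-round game: the dollar amount held in the
underlying asset during round `t`, as a function of the returns of the earlier rounds. -/
abbrev HedgingStrategy (τ : ℕ) : Type :=
  (t : Fin τ) → (Fin (t : ℕ) → ℝ) → ℝ

/-- The returns realized strictly before round `t`. -/
def returnHistory {τ : ℕ} (R : Fin τ → ℝ) (t : Fin τ) : Fin (t : ℕ) → ℝ :=
  fun s => R (Fin.castLE t.isLt.le s)

/-- The net amount that the seller of the option has to cover at the end of the game: the payoff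
at the final price `S₀ ∏ (1 + R t)` minus the gain `∑ R t * Δ t` of the hedge. -/
def netLoss (g : ℝ → ℝ) (S₀ : ℝ) {τ : ℕ} (Δ : HedgingStrategy τ) (R : Fin τ → ℝ) : ℝ :=
  g (S₀ * ∏ t, (1 + R t)) - ∑ t, R t * Δ t (returnHistory R t)

/-- The upper bound of the European option price in the `τ`-round hedging game with uncertainty
sets `U t`: the minimax, over the trader's strategies and nature's returns, of the net loss.
It is taken in the extended reals, since a bad strategy may have an unbounded loss. -/
def europeanUpperBound (g : ℝ → ℝ) (S₀ : ℝ) {τ : ℕ} (U : Fin τ → Set ℝ) : EReal :=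
  ⨅ Δ : HedgingStrategy τ, ⨆ (R : Fin τ → ℝ) (_ : ∀ t, R t ∈ U t), (netLoss g S₀ Δ R : EReal)

/-- Geometric Brownian motion with initial value `S₀`, drift `m` and volatility `σ`, driven by the
process `W`. -/
def geometricBrownianMotion {Ω : Type*} (S₀ m σ : ℝ) (W : ℝ≥0 → Ω → ℝ) (t : ℝ≥0) (ω : Ω) : ℝ :=
  S₀ * Real.exp (σ * W t ω + (m - σ ^ 2 / 2) * t)

end

/-! In one round with returns in `[-a, b]`, a convex payoff lies below its chord. Holding the
chord's slope leaves at most the chord's height at return 0, which is the mean of the payoff under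
the mean-zero law on `{-a, b}`. Against any other position, that law cancels the linear term, so an
endpoint costs at least this mean. Averaging preserves convexity, so backward induction makes the
game value the expectation of `g` under independent two-point returns
(`europeanUpperBound_eq_binomialValue`).

A round has variance `a * b`. The one-round characteristic function of the log-return is `exp
(-charExponent ξ * (a * b))` up to `O(δ * (a * b))` when `a, b ≤ δ`. The errors sum to `O(δ * ν)`,
so the log-return tends in law to `N(-ν/2, ν)` (`tendsto_charFun_logReturnLaw`). As `g` may grow
linearly, weak convergence alone is not enough; the bound `exp (∑ a * b)` on the second moment of
the price ratio controls the tails (`tendsto_integral_comp_exp`). -/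

noncomputable section

/-! ### The one-round game -/

/-- The probability of the upward move `b` under the mean-zero law supported on `{-a, b}`. -/
def upProb (a b : ℝ) : ℝ := a / (a + b)

lemma upProb_nonneg {a b : ℝ} (ha : 0 ≤ a) (hb : 0 ≤ b) : 0 ≤ upProb a b := by
  unfold upProb; positivity

lemma upProb_le_one {a b : ℝ} (ha : 0 ≤ a) (hb : 0 ≤ b) : upProb a b ≤ 1 :=
  div_le_one_of_le₀ (by linarith) (by linarith)

/-- Mean zero is what cancels terms linear in the return. If `a = b = 0`, then `0 / 0 = 0` is
harmless: both points coincide. -/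
lemma one_sub_upProb_mul {a b : ℝ} (ha : 0 ≤ a) (hb : 0 ≤ b) :
    (1 - upProb a b) * a = upProb a b * b := by
  unfold upProb
  rcases eq_or_lt_of_le (add_nonneg ha hb) with h | h
  · have ha' : a = 0 := by linarith
    simp [ha']
  · field_simp
    ring

lemma twoPoint_second_moment {a b : ℝ} (ha : 0 ≤ a) (hb : 0 ≤ b) :
    (1 - upProb a b) * a ^ 2 + upProb a b * b ^ 2 = a * b := by
  have h := one_sub_upProb_mul ha hb
  linear_combination (a - b) * h

/-- One-period expectation of `u` at price `s`, for the mean-zero return supported on `{-a, b}`. -/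
def twoPointMean (a b : ℝ) (u : ℝ → ℝ) (s : ℝ) : ℝ :=
  (1 - upProb a b) * u (s * (1 - a)) + upProb a b * u (s * (1 + b))

/-- Keeps the backward induction going; `a ≤ 1` keeps prices in the half-line where `u` is convex.
-/
lemma ConvexOn.twoPointMean {a b : ℝ} {u : ℝ → ℝ} (hu : ConvexOn ℝ (Set.Ici 0) u)
    (ha : 0 ≤ a) (ha1 : a ≤ 1) (hb : 0 ≤ b) :
    ConvexOn ℝ (Set.Ici 0) (twoPointMean a b u) := by
  have key : ∀ c : ℝ, 0 ≤ c → ConvexOn ℝ (Set.Ici 0) (fun s => u (s * c)) := by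
    intro c hc
    refine ⟨convex_Ici 0, fun x hx y hy r q hr hq hrq => ?_⟩
    have := hu.2 (x := x * c) (mul_nonneg hx hc) (y := y * c) (mul_nonneg hy hc) hr hq hrq
    simp only [smul_eq_mul] at this ⊢
    convert this using 2
    ring
  exact ((key (1 - a) (by linarith)).smul (sub_nonneg.2 (upProb_le_one ha hb))).add
    ((key (1 + b) (by linarith)).smul (upProb_nonneg ha hb))

/-- The delta hedge of the convex payoff `u` at price `s` against returns in `[-a, b]`. -/
def chordDelta (a b : ℝ) (u : ℝ → ℝ) (s : ℝ) : ℝ :=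
  (u (s * (1 + b)) - u (s * (1 - a))) / (a + b)

lemma sub_mul_chordDelta_le_twoPointMean {a b s r : ℝ} {u : ℝ → ℝ}
    (hu : ConvexOn ℝ (Set.Ici 0) u) (ha : 0 ≤ a) (ha1 : a ≤ 1) (hb : 0 ≤ b) (hs : 0 ≤ s)
    (hr : r ∈ Set.Icc (-a) b) :
    u (s * (1 + r)) - r * chordDelta a b u s ≤ twoPointMean a b u s := by
  obtain ⟨h1, h2⟩ := hr
  unfold chordDelta twoPointMean upProb
  rcases eq_or_lt_of_le (add_nonneg ha hb) with h | h
  · have ha' : a = 0 := by linarith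
    have hb' : b = 0 := by linarith
    have hr' : r = 0 := by linarith
    simp [ha', hb', hr']
  · have hc := hu.2 (show s * (1 - a) ∈ Set.Ici 0 from mul_nonneg hs (by linarith))
      (show s * (1 + b) ∈ Set.Ici 0 from mul_nonneg hs (by linarith))
      (show 0 ≤ (b - r) / (a + b) from div_nonneg (by linarith) h.le)
      (show 0 ≤ (r + a) / (a + b) from div_nonneg (by linarith) h.le) (by field_simp; ring)
    simp only [smul_eq_mul] at hc
    have e1 : (b - r) / (a + b) * (s * (1 - a)) + (r + a) / (a + b) * (s * (1 + b))
        = s * (1 + r) := by field_simp; ring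
    rw [e1] at hc
    refine (sub_le_sub_right hc _).trans (le_of_eq ?_)
    field_simp
    ring

/-- Whatever the position `d`, one of the two extreme returns costs at least the two-point mean. -/
lemma exists_twoPointMean_le {a b : ℝ} (ha : 0 ≤ a) (hb : 0 ≤ b) (u : ℝ → ℝ) (s d : ℝ) :
    ∃ r ∈ Set.Icc (-a) b, twoPointMean a b u s ≤ u (s * (1 + r)) - r * d := by
  by_contra! h
  have h1 := h (-a) ⟨le_rfl, by linarith⟩
  have h2 := h b ⟨by linarith, le_rfl⟩
  have hp := upProb_nonneg ha hb
  have hq := sub_nonneg.2 (upProb_le_one ha hb)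
  have hm := one_sub_upProb_mul ha hb
  rw [← sub_eq_add_neg] at h1
  set m := twoPointMean a b u s with hmdef
  -- The position `d` drops out, so `m` averages two costs assumed smaller than `m`; strictness
  -- comes from whichever weight is positive.
  have hm' : m = (1 - upProb a b) * (u (s * (1 - a)) - -a * d)
      + upProb a b * (u (s * (1 + b)) - b * d) := by
    rw [hmdef, twoPointMean]; linear_combination (-d) * hm
  rcases hp.eq_or_lt with h0 | h0
  · rw [← h0] at hm'; linarith
  · nlinarith

/-! ### Backward induction over rounds -/

/-- The iterated two-point expectation of the payoff `u` over `n` rounds. -/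
def binomialValue : (n : ℕ) → (Fin n → ℝ) → (Fin n → ℝ) → (ℝ → ℝ) → ℝ → ℝ
  | 0, _, _, u => u
  | n + 1, a, b, u => binomialValue n (fun i => a i.castSucc) (fun i => b i.castSucc)
      (twoPointMean (a (Fin.last n)) (b (Fin.last n)) u)

lemma netLoss_succ (g : ℝ → ℝ) (S₀ : ℝ) {n : ℕ} (Δ : HedgingStrategy (n + 1))
    (R : Fin (n + 1) → ℝ) :
    netLoss g S₀ Δ R =
      g ((S₀ * ∏ t : Fin n, (1 + R t.castSucc)) * (1 + R (Fin.last n)))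
        - R (Fin.last n) * Δ (Fin.last n) (fun t : Fin n => R t.castSucc)
        - ∑ t : Fin n, R t.castSucc *
            Δ t.castSucc (returnHistory (fun i : Fin n => R i.castSucc) t) := by
  unfold netLoss
  rw [Fin.prod_univ_castSucc, Fin.sum_univ_castSucc, ← mul_assoc, sub_sub,
    add_comm (R (Fin.last n) * _)]
  rfl

lemma exists_netLoss_le_binomialValue {n : ℕ} {a b : Fin n → ℝ} (ha : ∀ t, 0 ≤ a t)
    (ha1 : ∀ t, a t ≤ 1) (hb : ∀ t, 0 ≤ b t) {u : ℝ → ℝ} (hu : ConvexOn ℝ (Set.Ici 0) u)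
    {S₀ : ℝ} (hS₀ : 0 ≤ S₀) :
    ∃ Δ : HedgingStrategy n, ∀ R : Fin n → ℝ, (∀ t, R t ∈ Set.Icc (-a t) (b t)) →
      netLoss u S₀ Δ R ≤ binomialValue n a b u S₀ := by
  induction n generalizing u with
  | zero => exact ⟨fun t => t.elim0, fun R _ => by simp [netLoss, binomialValue]⟩
  | succ n ih =>
    obtain ⟨Δ, hΔ⟩ := ih (a := fun i => a i.castSucc) (b := fun i => b i.castSucc)
      (fun t => ha _) (fun t => ha1 _) (fun t => hb _)
      (hu.twoPointMean (ha (Fin.last n)) (ha1 (Fin.last n)) (hb (Fin.last n)))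
    -- Earlier positions hedge the averaged payoff; the last is the chord slope at the price then
    -- reached.
    let Δ' : HedgingStrategy (n + 1) := Fin.lastCases
      (motive := fun t : Fin (n + 1) => (Fin (t : ℕ) → ℝ) → ℝ)
      (fun H : Fin n → ℝ => chordDelta (a (Fin.last n)) (b (Fin.last n)) u
        (S₀ * ∏ t, (1 + H t)))
      (fun t => Δ t)
    refine ⟨Δ', fun R hR => ?_⟩
    have h := hΔ (fun i => R i.castSucc) (fun t => hR _)
    have hS : 0 ≤ S₀ * ∏ t : Fin n, (1 + R t.castSucc) :=
      mul_nonneg hS₀ (Finset.prod_nonneg fun t _ => by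
        linarith [(hR t.castSucc).1, ha1 t.castSucc])
    have h' := sub_mul_chordDelta_le_twoPointMean hu (ha (Fin.last n)) (ha1 (Fin.last n))
      (hb (Fin.last n)) hS (hR (Fin.last n))
    rw [netLoss_succ, binomialValue]
    refine le_trans ?_ h
    unfold netLoss
    simp only [Δ', Fin.lastCases_last, Fin.lastCases_castSucc]
    linarith

/-- Nature first plays against the averaged payoff; the last position is then a known number,
answered by an extreme return. No convexity enters. -/
lemma exists_binomialValue_le_netLoss {n : ℕ} {a b : Fin n → ℝ} (ha : ∀ t, 0 ≤ a t)
    (hb : ∀ t, 0 ≤ b t) (u : ℝ → ℝ) (S₀ : ℝ) (Δ : HedgingStrategy n) :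
    ∃ R : Fin n → ℝ, (∀ t, R t ∈ Set.Icc (-a t) (b t)) ∧
      binomialValue n a b u S₀ ≤ netLoss u S₀ Δ R := by
  induction n generalizing u with
  | zero => exact ⟨fun t => t.elim0, fun t => t.elim0, by simp [netLoss, binomialValue]⟩
  | succ n ih =>
    obtain ⟨R, hR, h⟩ := ih (a := fun i => a i.castSucc) (b := fun i => b i.castSucc)
      (fun t => ha _) (fun t => hb _) (twoPointMean (a (Fin.last n)) (b (Fin.last n)) u)
      (fun t => Δ t.castSucc)
    obtain ⟨r, hr, hr'⟩ := exists_twoPointMean_le (ha (Fin.last n)) (hb (Fin.last n)) u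
      (S₀ * ∏ t, (1 + R t)) (Δ (Fin.last n) R)
    refine ⟨Fin.snoc R r, fun t => ?_, ?_⟩
    · refine Fin.lastCases ?_ (fun i => ?_) t
      · simpa using hr
      · simpa using hR i
    · rw [netLoss_succ, binomialValue]
      refine h.trans ?_
      unfold netLoss
      simp only [Fin.snoc_castSucc, Fin.snoc_last]
      linarith

lemma europeanUpperBound_eq_binomialValue {n : ℕ} {a b : Fin n → ℝ} (ha : ∀ t, 0 ≤ a t)
    (ha1 : ∀ t, a t ≤ 1) (hb : ∀ t, 0 ≤ b t) {g : ℝ → ℝ} (hg : ConvexOn ℝ (Set.Ici 0) g)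
    {S₀ : ℝ} (hS₀ : 0 ≤ S₀) :
    europeanUpperBound g S₀ (fun t => Set.Icc (-a t) (b t))
      = (binomialValue n a b g S₀ : EReal) := by
  apply le_antisymm
  · obtain ⟨Δ, hΔ⟩ := exists_netLoss_le_binomialValue ha ha1 hb hg hS₀
    exact (iInf_le _ Δ).trans (iSup₂_le fun R hR => EReal.coe_le_coe_iff.2 (hΔ R hR))
  · refine le_iInf fun Δ => ?_
    obtain ⟨R, hR, h⟩ := exists_binomialValue_le_netLoss ha hb g S₀ Δ
    exact (EReal.coe_le_coe_iff.2 h).trans (le_iSup₂_of_le R hR le_rfl)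

/-! ### Law and moments of the log-return -/

/-- The law of the log-return over `n` rounds with independent mean-zero two-point returns. -/
def logReturnLaw : (n : ℕ) → (Fin n → ℝ) → (Fin n → ℝ) → Measure ℝ
  | 0, _, _ => Measure.dirac 0
  | n + 1, a, b =>
    ENNReal.ofReal (1 - upProb (a (Fin.last n)) (b (Fin.last n))) •
      (logReturnLaw n (fun i => a i.castSucc) (fun i => b i.castSucc)).map
        (fun y => y + Real.log (1 - a (Fin.last n))) +
    ENNReal.ofReal (upProb (a (Fin.last n)) (b (Fin.last n))) •
      (logReturnLaw n (fun i => a i.castSucc) (fun i => b i.castSucc)).map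
        (fun y => y + Real.log (1 + b (Fin.last n)))

lemma isProbabilityMeasure_logReturnLaw {n : ℕ} {a b : Fin n → ℝ} (ha : ∀ t, 0 ≤ a t)
    (hb : ∀ t, 0 ≤ b t) : IsProbabilityMeasure (logReturnLaw n a b) := by
  induction n with
  | zero => unfold logReturnLaw; infer_instance
  | succ n ih =>
    have := ih (a := fun i => a i.castSucc) (b := fun i => b i.castSucc)
      (fun t => ha _) (fun t => hb _)
    constructor
    rw [logReturnLaw]
    simp only [Measure.coe_add, Measure.coe_smul, Pi.add_apply, Pi.smul_apply, smul_eq_mul]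
    rw [Measure.map_apply (by fun_prop) .univ, Measure.map_apply (by fun_prop) .univ]
    simp only [Set.preimage_univ, measure_univ, mul_one]
    rw [← ENNReal.ofReal_add (sub_nonneg.2 (upProb_le_one (ha _) (hb _)))
      (upProb_nonneg (ha _) (hb _))]
    simp

/-- The law is a finite combination of point masses, so no growth condition is needed. -/
lemma integrable_logReturnLaw {E : Type*} [NormedAddCommGroup E] {n : ℕ} (a b : Fin n → ℝ)
    {f : ℝ → E} (hf : StronglyMeasurable f) :
    Integrable f (logReturnLaw n a b) := by
  induction n generalizing f with
  | zero => exact integrable_dirac (by simp [enorm_lt_top])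
  | succ n ih =>
    have key : ∀ c : ℝ, Integrable f
        ((logReturnLaw n (fun i => a i.castSucc) (fun i => b i.castSucc)).map (fun y => y + c)) :=
      fun c => (integrable_map_measure hf.aestronglyMeasurable (by fun_prop)).2
        (ih _ _ (hf.comp_measurable (by fun_prop)))
    exact ((key _).smul_measure ENNReal.ofReal_ne_top).add_measure
      ((key _).smul_measure ENNReal.ofReal_ne_top)

lemma integral_logReturnLaw_succ {E : Type*} [NormedAddCommGroup E] [NormedSpace ℝ E] {n : ℕ}
    {a b : Fin (n + 1) → ℝ}
    (ha : ∀ t, 0 ≤ a t) (hb : ∀ t, 0 ≤ b t) {f : ℝ → E} (hf : StronglyMeasurable f) :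
    ∫ y, f y ∂(logReturnLaw (n + 1) a b) =
      ∫ y, ((1 - upProb (a (Fin.last n)) (b (Fin.last n))) •
          f (y + Real.log (1 - a (Fin.last n))) +
        upProb (a (Fin.last n)) (b (Fin.last n)) • f (y + Real.log (1 + b (Fin.last n))))
        ∂(logReturnLaw n (fun i => a i.castSucc) (fun i => b i.castSucc)) := by
  have hi : ∀ c : ℝ, Integrable (fun y => f (y + c))
      (logReturnLaw n (fun i => a i.castSucc) (fun i => b i.castSucc)) :=
    fun c => integrable_logReturnLaw _ _ (hf.comp_measurable (by fun_prop))
  have hm : ∀ c : ℝ, Integrable f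
      ((logReturnLaw n (fun i => a i.castSucc) (fun i => b i.castSucc)).map (fun y => y + c)) :=
    fun c => (integrable_map_measure hf.aestronglyMeasurable (by fun_prop)).2 (hi c)
  rw [logReturnLaw, integral_add_measure ((hm _).smul_measure ENNReal.ofReal_ne_top)
    ((hm _).smul_measure ENNReal.ofReal_ne_top), integral_smul_measure, integral_smul_measure,
    integral_map (by fun_prop) hf.aestronglyMeasurable,
    integral_map (by fun_prop) hf.aestronglyMeasurable,
    integral_add ((hi _).fun_smul _) ((hi _).fun_smul _), integral_smul, integral_smul,
    ENNReal.toReal_ofReal (upProb_nonneg (ha _) (hb _)),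
    ENNReal.toReal_ofReal (sub_nonneg.2 (upProb_le_one (ha _) (hb _)))]

/-- Strictness of `a t < 1` is needed for `exp (log (1 - a t)) = 1 - a t`. -/
lemma binomialValue_eq_integral {n : ℕ} {a b : Fin n → ℝ} (ha : ∀ t, 0 ≤ a t)
    (ha1 : ∀ t, a t < 1) (hb : ∀ t, 0 ≤ b t) {u : ℝ → ℝ} (hu : Measurable u) (s : ℝ) :
    binomialValue n a b u s = ∫ y, u (s * Real.exp y) ∂(logReturnLaw n a b) := by
  induction n generalizing u with
  | zero => simp [binomialValue, logReturnLaw]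
  | succ n ih =>
    have hT : Measurable (twoPointMean (a (Fin.last n)) (b (Fin.last n)) u) := by
      unfold twoPointMean; fun_prop
    rw [binomialValue, ih (fun t => ha _) (fun t => ha1 _) (fun t => hb _) hT,
      integral_logReturnLaw_succ ha hb (by fun_prop : Measurable _).stronglyMeasurable]
    refine integral_congr_ae (.of_forall fun y => ?_)
    have h1 : 0 < 1 - a (Fin.last n) := sub_pos.2 (ha1 _)
    have h2 : 0 < 1 + b (Fin.last n) := by linarith [hb (Fin.last n)]
    simp only [twoPointMean, Real.exp_add, Real.exp_log h1, Real.exp_log h2, smul_eq_mul,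
      mul_assoc]

/-- A multiplicative character of the log-return integrates to the product of the one-round means. -/
lemma integral_logReturnLaw_of_map_add {n : ℕ} {a b : Fin n → ℝ} (ha : ∀ t, 0 ≤ a t)
    (hb : ∀ t, 0 ≤ b t) {𝕜 : Type*} [RCLike 𝕜] {f : ℝ → 𝕜} (hf : StronglyMeasurable f)
    (h0 : f 0 = 1) (hadd : ∀ x y, f (x + y) = f x * f y) :
    ∫ y, f y ∂(logReturnLaw n a b) =
      ∏ t, ((1 - upProb (a t) (b t)) • f (Real.log (1 - a t)) +
        upProb (a t) (b t) • f (Real.log (1 + b t))) := by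
  induction n with
  | zero => simp [logReturnLaw, h0]
  | succ n ih =>
    rw [integral_logReturnLaw_succ ha hb hf, Fin.prod_univ_castSucc,
      ← ih (fun t => ha _) (fun t => hb _), ← integral_mul_const]
    refine integral_congr_ae (.of_forall fun y => ?_)
    simp only [hadd, mul_add, mul_smul_comm]

lemma integral_exp_two_mul_logReturnLaw {n : ℕ} {a b : Fin n → ℝ} (ha : ∀ t, 0 ≤ a t)
    (ha1 : ∀ t, a t < 1) (hb : ∀ t, 0 ≤ b t) :
    ∫ y, Real.exp (2 * y) ∂(logReturnLaw n a b) = ∏ t, (1 + a t * b t) := by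
  rw [integral_logReturnLaw_of_map_add ha hb
    (by fun_prop : Measurable fun y : ℝ => Real.exp (2 * y)).stronglyMeasurable (by simp)
    (fun x y => by rw [mul_add, Real.exp_add])]
  refine Finset.prod_congr rfl fun t _ => ?_
  have e : ∀ x : ℝ, 0 < x → Real.exp (2 * Real.log x) = x ^ 2 := fun x hx => by
    rw [two_mul, Real.exp_add, Real.exp_log hx, sq]
  rw [e _ (sub_pos.2 (ha1 t)), e _ (by linarith [hb t])]
  simp only [smul_eq_mul]
  linear_combination twoPoint_second_moment (ha t) (hb t) - 2 * one_sub_upProb_mul (ha t) (hb t)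

lemma integral_exp_two_mul_logReturnLaw_le {n : ℕ} {a b : Fin n → ℝ} (ha : ∀ t, 0 ≤ a t)
    (ha1 : ∀ t, a t < 1) (hb : ∀ t, 0 ≤ b t) :
    ∫ y, Real.exp (2 * y) ∂(logReturnLaw n a b) ≤ Real.exp (∑ t, a t * b t) := by
  rw [integral_exp_two_mul_logReturnLaw ha ha1 hb, Real.exp_sum]
  refine Finset.prod_le_prod (fun t _ => ?_) (fun t _ => ?_)
  · linarith [mul_nonneg (ha t) (hb t)]
  · linarith [Real.add_one_le_exp (a t * b t)]

/-! ### Characteristic function asymptotics -/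

/-- The one-round characteristic function of the log-return. -/
def twoPointCharFun (a b ξ : ℝ) : ℂ :=
  (1 - upProb a b) • Complex.exp (ξ * Real.log (1 - a) * Complex.I) +
    upProb a b • Complex.exp (ξ * Real.log (1 + b) * Complex.I)

lemma charFun_logReturnLaw {n : ℕ} {a b : Fin n → ℝ} (ha : ∀ t, 0 ≤ a t)
    (hb : ∀ t, 0 ≤ b t) (ξ : ℝ) :
    charFun (logReturnLaw n a b) ξ = ∏ t, twoPointCharFun (a t) (b t) ξ := by
  rw [charFun_apply_real, integral_logReturnLaw_of_map_add ha hb (f := fun x : ℝ =>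
    Complex.exp (ξ * x * Complex.I)) (by fun_prop : Measurable _).stronglyMeasurable (by simp)
    (fun x y => by rw [← Complex.exp_add]; push_cast; ring_nf)]
  rfl

lemma norm_twoPointCharFun_le_one {a b : ℝ} (ha : 0 ≤ a) (hb : 0 ≤ b) (ξ : ℝ) :
    ‖twoPointCharFun a b ξ‖ ≤ 1 := by
  refine (norm_add_le _ _).trans ?_
  rw [norm_smul, norm_smul, ← Complex.ofReal_mul, ← Complex.ofReal_mul,
    Complex.norm_exp_ofReal_mul_I, Complex.norm_exp_ofReal_mul_I,
    Real.norm_of_nonneg (upProb_nonneg ha hb),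
    Real.norm_of_nonneg (sub_nonneg.2 (upProb_le_one ha hb))]
  simp

open Asymptotics in
/-- Second-order expansion of `(1 + x) ^ (iξ)` at `x = 0`. -/
lemma isBigO_exp_log_one_add_sub (ξ : ℝ) :
    (fun x : ℝ => Complex.exp (ξ * Real.log (1 + x) * Complex.I) -
      (1 + ξ * Complex.I * x - (ξ ^ 2 + ξ * Complex.I) / 2 * x ^ 2)) =O[𝓝 0]
      fun x : ℝ => x ^ 3 := by
  have hlog : (fun x : ℝ => Real.log (1 + x) - (x - x ^ 2 / 2)) =O[𝓝 0] fun x : ℝ => x ^ 3 := by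
    -- The Taylor remainder `|x| ^ 3 / (1 - |x|)` is at most `2 * |x| ^ 3` for `|x| < 1 / 2`.
    refine IsBigO.of_bound 2 ?_
    filter_upwards [Metric.ball_mem_nhds (0 : ℝ) (by norm_num : (0 : ℝ) < 1 / 2)] with x hx
    rw [mem_ball_zero_iff, Real.norm_eq_abs] at hx
    have h := Real.abs_log_sub_add_sum_range_le (x := -x) (by rw [abs_neg]; linarith) 2
    simp only [Finset.sum_range_succ, Finset.sum_range_zero, abs_neg, sub_neg_eq_add] at h
    rw [norm_pow, Real.norm_eq_abs, Real.norm_eq_abs]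
    have e : Real.log (1 + x) - (x - x ^ 2 / 2) = 0 + (-x) ^ (0 + 1) / ((0 : ℕ) + 1) +
        (-x) ^ (1 + 1) / ((1 : ℕ) + 1) + Real.log (1 + x) := by push_cast; ring
    rw [e]
    refine h.trans ?_
    rw [div_le_iff₀ (by linarith)]
    norm_num only
    nlinarith [mul_nonneg (pow_nonneg (abs_nonneg x) 3) (by linarith : 0 ≤ 1 - 2 * |x|)]
  have hpow : ∀ {m n : ℕ}, n ≤ m → (fun x : ℝ => x ^ m) =O[𝓝 0] fun x : ℝ => x ^ n :=
    fun h => IsBigO.of_bound 1 (by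
      filter_upwards [Metric.ball_mem_nhds (0 : ℝ) one_pos] with x hx
      rw [mem_ball_zero_iff] at hx
      rw [norm_pow, norm_pow, one_mul]
      exact pow_le_pow_of_le_one (norm_nonneg _) hx.le h)
  have hid : (fun x : ℝ => x) =O[𝓝 0] fun x : ℝ => x := isBigO_refl _ _
  have hsub : (fun x : ℝ => Real.log (1 + x) - x) =O[𝓝 0] fun x : ℝ => x ^ 2 := by
    have h := (hlog.trans (hpow (by norm_num : 2 ≤ 3))).sub
      ((isBigO_refl (fun x : ℝ => x ^ 2) (𝓝 0)).const_mul_left (1 / 2))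
    exact h.congr_left fun x => by ring
  have hlin : (fun x : ℝ => Real.log (1 + x)) =O[𝓝 0] fun x : ℝ => x := by
    have h := (hsub.trans (hpow (by norm_num : 1 ≤ 2))).add
      (by simpa using hid : (fun x : ℝ => x) =O[𝓝 0] fun x : ℝ => x ^ 1)
    simpa using h
  have hsq : (fun x : ℝ => Real.log (1 + x) ^ 2 - x ^ 2) =O[𝓝 0] fun x : ℝ => x ^ 3 :=
    (hsub.mul (hlin.add hid)).congr (fun x => by ring) (fun x => by ring)
  have hexp : (fun x : ℝ => Complex.exp (ξ * Real.log (1 + x) * Complex.I) -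
      (1 + ξ * Real.log (1 + x) * Complex.I + (ξ * Real.log (1 + x) * Complex.I) ^ 2 / 2))
      =O[𝓝 0] fun x : ℝ => x ^ 3 := by
    have hw : (fun x : ℝ => (ξ * Real.log (1 + x) * Complex.I : ℂ)) =O[𝓝 0] fun x : ℝ => x := by
      refine ((hlin.const_mul_left ξ).norm_left.congr_left fun x => ?_).of_norm_left
      simp
    have ht : Tendsto (fun x : ℝ => (ξ * Real.log (1 + x) * Complex.I : ℂ)) (𝓝 0) (𝓝 0) :=
      hw.trans_tendsto tendsto_id
    refine IsBigO.trans (IsBigO.of_bound 1 ?_) (hw.pow 3)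
    filter_upwards [ht (Metric.closedBall_mem_nhds 0 one_pos)] with x hx
    have hx' : ‖(ξ * Real.log (1 + x) * Complex.I : ℂ)‖ ≤ 1 := by simpa using hx
    have h := Complex.exp_bound hx' (n := 3) (by norm_num)
    simp only [Finset.sum_range_succ, Finset.sum_range_zero] at h
    rw [norm_pow]
    norm_num [Nat.factorial] at h ⊢
    refine h.trans ?_
    nlinarith [pow_nonneg (mul_nonneg (abs_nonneg ξ) (abs_nonneg (Real.log (1 + x)))) 3]
  have h1 : (fun x : ℝ => ξ * Complex.I * ((Real.log (1 + x) - (x - x ^ 2 / 2) : ℝ) : ℂ))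
      =O[𝓝 0] fun x : ℝ => x ^ 3 := (Complex.isBigO_ofReal_left.2 hlog).const_mul_left _
  have h2 : (fun x : ℝ => (ξ : ℂ) ^ 2 / 2 * ((Real.log (1 + x) ^ 2 - x ^ 2 : ℝ) : ℂ))
      =O[𝓝 0] fun x : ℝ => x ^ 3 := (Complex.isBigO_ofReal_left.2 hsq).const_mul_left _
  refine ((hexp.add h1).sub h2).congr_left fun x => ?_
  rw [Complex.ofReal_sub, Complex.ofReal_sub, Complex.ofReal_sub]
  push_cast
  linear_combination (-(ξ : ℂ) ^ 2 * (Real.log (1 + x) : ℂ) ^ 2 / 2) * Complex.I_sq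

/-- The negated characteristic exponent of the Gaussian law with mean `-1/2` and variance `1`. -/
def charExponent (ξ : ℝ) : ℂ := (ξ ^ 2 + ξ * Complex.I) / 2

lemma norm_exp_neg_charExponent_mul_le_one (ξ : ℝ) {v : ℝ} (hv : 0 ≤ v) :
    ‖Complex.exp (-charExponent ξ * v)‖ ≤ 1 := by
  rw [Complex.norm_exp, Real.exp_le_one_iff]
  have : (-charExponent ξ * v).re = -(ξ ^ 2 / 2 * v) := by
    simp [charExponent, pow_two]
  rw [this]
  have : 0 ≤ ξ ^ 2 / 2 * v := by positivity
  linarith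

/-- The first two moments match; third moments are at most `δ` times the variance. The factor `a *
b` makes the errors summable over rounds. -/
lemma exists_norm_twoPointCharFun_sub_exp_le (ξ : ℝ) :
    ∃ C : ℝ, ∀ᶠ δ in 𝓝 (0 : ℝ), ∀ a b : ℝ, 0 ≤ a → 0 ≤ b → a ≤ δ → b ≤ δ →
      ‖twoPointCharFun a b ξ - Complex.exp (-charExponent ξ * (a * b : ℝ))‖ ≤
        C * δ * (a * b) := by
  obtain ⟨C, hC, hbound⟩ := (isBigO_exp_log_one_add_sub ξ).exists_nonneg
  obtain ⟨r, hr, hball⟩ := Metric.eventually_nhds_iff.1 hbound.bound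
  refine ⟨C + ‖charExponent ξ‖ ^ 2, ?_⟩
  have hcont : Tendsto (fun δ : ℝ => ‖charExponent ξ‖ * δ ^ 2) (𝓝 0) (𝓝 0) := by
    have : Continuous fun δ : ℝ => ‖charExponent ξ‖ * δ ^ 2 := by fun_prop
    simpa using this.tendsto 0
  -- `δ < 1` gives `a * b ≤ δ ^ 2 ≤ δ`; the last condition puts the exponent in the unit disc.
  filter_upwards [gt_mem_nhds hr, gt_mem_nhds one_pos, hcont.eventually (gt_mem_nhds one_pos)]
    with δ hδr hδ1 hδc a b ha hb haδ hbδ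
  have hδ : 0 ≤ δ := ha.trans haδ
  have hv : 0 ≤ a * b := mul_nonneg ha hb
  have hvδ : a * b ≤ δ ^ 2 := by nlinarith
  have hp := upProb_nonneg ha hb
  have hq := sub_nonneg.2 (upProb_le_one ha hb)
  have hE1 := hball (y := -a) (by simpa [abs_of_nonneg ha] using haδ.trans_lt hδr)
  have hE2 := hball (y := b) (by simpa [abs_of_nonneg hb] using hbδ.trans_lt hδr)
  rw [norm_pow, norm_neg, Real.norm_of_nonneg ha, ← sub_eq_add_neg] at hE1
  rw [norm_pow, Real.norm_of_nonneg hb] at hE2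
  have hexp := Complex.norm_exp_sub_one_sub_id_le (x := -charExponent ξ * (a * b : ℝ)) (by
    rw [norm_mul, norm_neg, Complex.norm_real, Real.norm_of_nonneg hv]
    exact (mul_le_mul_of_nonneg_left hvδ (norm_nonneg _)).trans hδc.le)
  rw [norm_mul, norm_neg, Complex.norm_real, Real.norm_of_nonneg hv] at hexp
  set E₁ := Complex.exp (ξ * Real.log (1 - a) * Complex.I) -
      (1 + ξ * Complex.I * (-a : ℝ) - (ξ ^ 2 + ξ * Complex.I) / 2 * (-a : ℝ) ^ 2) with hE₁
  set E₂ := Complex.exp (ξ * Real.log (1 + b) * Complex.I) -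
      (1 + ξ * Complex.I * b - (ξ ^ 2 + ξ * Complex.I) / 2 * b ^ 2) with hE₂
  set E₃ := Complex.exp (-charExponent ξ * (a * b : ℝ)) - 1 - -charExponent ξ * (a * b : ℝ)
    with hE₃
  have hm : ((1 : ℂ) - upProb a b) * a = upProb a b * b := by
    exact_mod_cast one_sub_upProb_mul ha hb
  have hs : ((1 : ℂ) - upProb a b) * a ^ 2 + upProb a b * b ^ 2 = a * b := by
    exact_mod_cast twoPoint_second_moment ha hb
  have hdecomp : twoPointCharFun a b ξ - Complex.exp (-charExponent ξ * (a * b : ℝ)) =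
      (1 - upProb a b) • E₁ + upProb a b • E₂ - E₃ := by
    rw [hE₁, hE₂, hE₃, twoPointCharFun]
    simp only [Complex.real_smul, charExponent]
    push_cast
    linear_combination (-ξ * Complex.I) * hm - (ξ ^ 2 + ξ * Complex.I) / 2 * hs
  have hcube : (1 - upProb a b) * a ^ 3 + upProb a b * b ^ 3 ≤ δ * (a * b) := by
    rw [← twoPoint_second_moment ha hb]
    nlinarith [mul_le_mul_of_nonneg_left haδ (mul_nonneg hq (sq_nonneg a)),
      mul_le_mul_of_nonneg_left hbδ (mul_nonneg hp (sq_nonneg b))]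
  rw [hdecomp]
  calc ‖(1 - upProb a b) • E₁ + upProb a b • E₂ - E₃‖
      ≤ ‖(1 - upProb a b) • E₁‖ + ‖upProb a b • E₂‖ + ‖E₃‖ :=
        (norm_sub_le _ _).trans (by gcongr; exact norm_add_le _ _)
    _ ≤ (1 - upProb a b) * (C * a ^ 3) + upProb a b * (C * b ^ 3)
          + (‖charExponent ξ‖ * (a * b)) ^ 2 := by
        rw [norm_smul, norm_smul, Real.norm_of_nonneg hp, Real.norm_of_nonneg hq]
        gcongr
    _ = C * ((1 - upProb a b) * a ^ 3 + upProb a b * b ^ 3)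
          + ‖charExponent ξ‖ ^ 2 * ((a * b) * (a * b)) := by ring
    _ ≤ C * (δ * (a * b)) + ‖charExponent ξ‖ ^ 2 * (δ * (a * b)) := by
        gcongr
        nlinarith
    _ = (C + ‖charExponent ξ‖ ^ 2) * δ * (a * b) := by ring

/-- Factors are exchanged one at a time, the others having norm at most 1. -/
lemma norm_prod_sub_prod_le_sum {ι : Type*} (s : Finset ι) {z w : ι → ℂ}
    (hz : ∀ i ∈ s, ‖z i‖ ≤ 1) (hw : ∀ i ∈ s, ‖w i‖ ≤ 1) :
    ‖∏ i ∈ s, z i - ∏ i ∈ s, w i‖ ≤ ∑ i ∈ s, ‖z i - w i‖ := by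
  classical
  induction s using Finset.induction_on with
  | empty => simp
  | insert i s hi ih =>
    rw [Finset.prod_insert hi, Finset.prod_insert hi, Finset.sum_insert hi]
    have h1 := ih (fun j hj => hz j (Finset.mem_insert_of_mem hj))
      (fun j hj => hw j (Finset.mem_insert_of_mem hj))
    have h2 : ‖∏ j ∈ s, w j‖ ≤ 1 := by
      rw [norm_prod]
      exact Finset.prod_le_one (fun _ _ => norm_nonneg _)
        (fun j hj => hw j (Finset.mem_insert_of_mem hj))
    have e : z i * ∏ j ∈ s, z j - w i * ∏ j ∈ s, w j
        = (z i - w i) * ∏ j ∈ s, w j + z i * (∏ j ∈ s, z j - ∏ j ∈ s, w j) := by ring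
    rw [e]
    refine (norm_add_le _ _).trans ?_
    rw [norm_mul, norm_mul]
    refine add_le_add (mul_le_of_le_one_right (norm_nonneg _) h2) (le_trans ?_ h1)
    exact mul_le_of_le_one_left (norm_nonneg _) (hz i (Finset.mem_insert_self _ _))

lemma charFun_gaussianReal_neg_half (v : ℝ≥0) (ξ : ℝ) :
    charFun (gaussianReal (-(v : ℝ) / 2) v) ξ = Complex.exp (-charExponent ξ * (v : ℝ)) := by
  rw [charFun_gaussianReal, charExponent]
  congr 1
  push_cast
  ring

/-! ### Central limit theorem for the log-return -/

section Convergence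

variable {a b : (n : ℕ) → Fin n → ℝ} {v : ℝ≥0}

lemma le_iSup_max {n : ℕ} (x y : Fin n → ℝ) (t : Fin n) :
    x t ≤ ⨆ t, max (x t) (y t) ∧ y t ≤ ⨆ t, max (x t) (y t) :=
  max_le_iff.1 (le_ciSup (f := fun t => max (x t) (y t)) (Set.finite_range _).bddAbove t)

lemma tendsto_charFun_logReturnLaw (ha : ∀ n t, 0 ≤ a n t) (hb : ∀ n t, 0 ≤ b n t)
    (hsum : Tendsto (fun n : ℕ => ∑ t : Fin n, a n t * b n t) atTop (𝓝 v))
    (hsup : Tendsto (fun n : ℕ => ⨆ t : Fin n, max (a n t) (b n t)) atTop (𝓝 0)) (ξ : ℝ) :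
    Tendsto (fun n => charFun (logReturnLaw n (a n) (b n)) ξ) atTop
      (𝓝 (charFun (gaussianReal (-(v : ℝ) / 2) v) ξ)) := by
  rw [charFun_gaussianReal_neg_half]
  have hlim : Tendsto (fun n : ℕ =>
      Complex.exp (-charExponent ξ * (∑ t : Fin n, a n t * b n t : ℝ))) atTop
      (𝓝 (Complex.exp (-charExponent ξ * (v : ℝ)))) := by
    have hc : Continuous fun x : ℝ => Complex.exp (-charExponent ξ * x) := by fun_prop
    exact (hc.tendsto _).comp hsum
  obtain ⟨C, hC⟩ := exists_norm_twoPointCharFun_sub_exp_le ξ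
  have hdiff : Tendsto (fun n : ℕ => charFun (logReturnLaw n (a n) (b n)) ξ -
      Complex.exp (-charExponent ξ * (∑ t : Fin n, a n t * b n t : ℝ))) atTop (𝓝 0) := by
    have h0 : Tendsto (fun n : ℕ => C * (⨆ t : Fin n, max (a n t) (b n t)) *
        ∑ t : Fin n, a n t * b n t) atTop (𝓝 0) := by
      simpa using (hsup.const_mul C).mul hsum
    refine squeeze_zero_norm' ?_ h0
    -- The one-round estimate is used with `δ` equal to the supremum itself.
    filter_upwards [hsup.eventually hC] with n hn
    rw [charFun_logReturnLaw (ha n) (hb n), Complex.ofReal_sum, Finset.mul_sum, Complex.exp_sum,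
      Finset.mul_sum]
    refine (norm_prod_sub_prod_le_sum _
      (fun t _ => norm_twoPointCharFun_le_one (ha n t) (hb n t) ξ)
      (fun t _ => norm_exp_neg_charExponent_mul_le_one ξ
        (mul_nonneg (ha n t) (hb n t)))).trans (Finset.sum_le_sum fun t _ => ?_)
    have h := le_iSup_max (a n) (b n) t
    exact hn _ _ (ha n t) (hb n t) h.1 h.2
  simpa using hdiff.add hlim

end Convergence

/-! ### From weak convergence to Lipschitz payoffs -/

section Lipschitz

variable {u : ℝ → ℝ} {L : ℝ≥0} {s : ℝ}

/-- Beyond `M`, `exp y ≤ exp (-M) * exp (2 * y)`: a second moment buys a small factor. -/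
lemma abs_comp_exp_sub_comp_exp_min_le (hu : LipschitzWith L u) (hs : 0 ≤ s) (M y : ℝ) :
    |u (s * Real.exp y) - u (s * Real.exp (min y M))| ≤
      L * s * Real.exp (-M) * Real.exp (2 * y) := by
  rcases le_total y M with h | h
  · rw [min_eq_left h, sub_self, abs_zero]; positivity
  · rw [min_eq_right h]
    have h1 := hu.dist_le_mul (s * Real.exp y) (s * Real.exp M)
    rw [Real.dist_eq, Real.dist_eq, ← mul_sub, abs_mul, abs_of_nonneg hs,
      abs_of_nonneg (sub_nonneg.2 (Real.exp_le_exp.2 h)), ← mul_assoc] at h1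
    refine h1.trans ?_
    rw [mul_assoc (L * s : ℝ), ← Real.exp_add]
    refine mul_le_mul_of_nonneg_left ?_ (by positivity)
    have : Real.exp y ≤ Real.exp (-M + 2 * y) := Real.exp_le_exp.2 (by linarith)
    linarith [Real.exp_pos M]

/-- The payoff at the price `s * exp y`, truncated at `y = M`, as a bounded continuous function. -/
def truncatedPayoff (hu : LipschitzWith L u) (s M : ℝ) : BoundedContinuousFunction ℝ ℝ :=
  BoundedContinuousFunction.ofNormedAddCommGroup (fun y => u (s * Real.exp (min y M)))
    (by have := hu.continuous; fun_prop) (|u 0| + L * (|s| * Real.exp M)) (fun y => by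
      have h1 := hu.dist_le_mul (s * Real.exp (min y M)) 0
      rw [Real.dist_eq, Real.dist_eq, sub_zero, abs_mul, abs_of_pos (Real.exp_pos _)] at h1
      have h2 : (L : ℝ) * (|s| * Real.exp (min y M)) ≤ L * (|s| * Real.exp M) := by
        gcongr; exact min_le_right _ _
      have h3 := abs_sub_abs_le_abs_sub (u (s * Real.exp (min y M))) (u 0)
      rw [Real.norm_eq_abs]
      linarith)

lemma LipschitzWith.integrable_comp_exp (hu : LipschitzWith L u) (hs : 0 ≤ s) {μ : Measure ℝ}
    [IsFiniteMeasure μ] (hμ : Integrable (fun y => Real.exp (2 * y)) μ) :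
    Integrable (fun y => u (s * Real.exp y)) μ := by
  have hd : Integrable (fun y => u (s * Real.exp y) - u (s * Real.exp (min y 0))) μ := by
    refine (hμ.const_mul (L * s * Real.exp (-0))).mono' ?_ (.of_forall fun y => ?_)
    · have := hu.continuous
      exact (by fun_prop : Continuous fun y : ℝ =>
        u (s * Real.exp y) - u (s * Real.exp (min y 0))).aestronglyMeasurable
    · exact abs_comp_exp_sub_comp_exp_min_le hu hs 0 y
  have := hd.add ((truncatedPayoff hu s 0).integrable μ)
  refine this.congr (.of_forall fun y => ?_)
  simp [truncatedPayoff]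

lemma abs_integral_sub_integral_truncatedPayoff_le (hu : LipschitzWith L u) (hs : 0 ≤ s)
    {μ : Measure ℝ} [IsFiniteMeasure μ] (hμ : Integrable (fun y => Real.exp (2 * y)) μ) (M : ℝ) :
    |∫ y, u (s * Real.exp y) ∂μ - ∫ y, truncatedPayoff hu s M y ∂μ| ≤
      L * s * Real.exp (-M) * ∫ y, Real.exp (2 * y) ∂μ := by
  rw [← integral_sub (hu.integrable_comp_exp hs hμ) ((truncatedPayoff hu s M).integrable μ),
    ← integral_const_mul]
  rw [← Real.norm_eq_abs]
  refine norm_integral_le_of_norm_le (hμ.const_mul _) (.of_forall fun y => ?_)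
  exact abs_comp_exp_sub_comp_exp_min_le hu hs M y

/-- Weak convergence together with bounded second exponential moments passes Lipschitz payoffs
of the exponential to the limit. -/
lemma tendsto_integral_comp_exp (hu : LipschitzWith L u) (hs : 0 ≤ s)
    {μ : ℕ → ProbabilityMeasure ℝ} {μ₀ : ProbabilityMeasure ℝ} (hμ : Tendsto μ atTop (𝓝 μ₀))
    (hint : ∀ n, Integrable (fun y => Real.exp (2 * y)) (μ n : Measure ℝ))
    (hint₀ : Integrable (fun y => Real.exp (2 * y)) (μ₀ : Measure ℝ)) {B : ℝ}
    (hB : ∀ᶠ n in atTop, ∫ y, Real.exp (2 * y) ∂(μ n : Measure ℝ) ≤ B) :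
    Tendsto (fun n => ∫ y, u (s * Real.exp y) ∂(μ n : Measure ℝ)) atTop
      (𝓝 (∫ y, u (s * Real.exp y) ∂(μ₀ : Measure ℝ))) := by
  set B₀ := ∫ y, Real.exp (2 * y) ∂(μ₀ : Measure ℝ)
  rw [Metric.tendsto_nhds]
  intro ε hε
  -- `M` is fixed before `n`; `max B B₀` bounds both tails at once.
  have hM : Tendsto (fun M : ℝ => L * s * Real.exp (-M) * max B B₀) atTop (𝓝 0) := by
    have h := (Real.tendsto_exp_atBot.comp tendsto_neg_atTop_atBot).const_mul (L * s : ℝ)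
    simpa using h.mul_const (max B B₀)
  obtain ⟨M, hM⟩ := (hM.eventually (gt_mem_nhds (by positivity : 0 < ε / 3))).exists
  have hT := (ProbabilityMeasure.tendsto_iff_forall_integral_tendsto.1 hμ)
    (truncatedPayoff hu s M)
  filter_upwards [Metric.tendsto_nhds.1 hT (ε / 3) (by positivity), hB] with n hn hBn
  have h1 := abs_integral_sub_integral_truncatedPayoff_le hu hs (hint n) M
  have h2 := abs_integral_sub_integral_truncatedPayoff_le hu hs hint₀ M
  have hK : (0 : ℝ) ≤ L * s * Real.exp (-M) := by positivity
  have h1' := h1.trans (mul_le_mul_of_nonneg_left (hBn.trans (le_max_left B B₀)) hK)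
  have h2' := h2.trans (mul_le_mul_of_nonneg_left (le_max_right B B₀) hK)
  rw [Real.dist_eq] at hn ⊢
  rw [abs_le] at h1' h2'
  rw [abs_lt] at hn ⊢
  constructor <;> linarith [hn.1, hn.2, h1'.1, h1'.2, h2'.1, h2'.2]

end Lipschitz

/-! ### Extension of the payoff and Gaussian laws -/

/-- `g` is arbitrary on negative prices; this replaces it by a globally Lipschitz function agreeing
with it on `[0, ∞)`. -/
lemma LipschitzOnWith.lipschitzWith_comp_max {g : ℝ → ℝ} {L : ℝ≥0}
    (hg : LipschitzOnWith L g (Set.Ici 0)) : LipschitzWith L (fun x => g (max x 0)) := by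
  refine LipschitzWith.of_dist_le_mul fun x y => ?_
  refine (hg.dist_le_mul _ (le_max_right x 0) _ (le_max_right y 0)).trans ?_
  refine mul_le_mul_of_nonneg_left ?_ L.coe_nonneg
  rw [Real.dist_eq, Real.dist_eq]
  exact abs_max_sub_max_le_abs x y 0

lemma binomialValue_congr {n : ℕ} {a b : Fin n → ℝ} (ha1 : ∀ t, a t ≤ 1) (hb : ∀ t, 0 ≤ b t)
    {u w : ℝ → ℝ} (h : Set.EqOn u w (Set.Ici 0)) :
    Set.EqOn (binomialValue n a b u) (binomialValue n a b w) (Set.Ici 0) := by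
  induction n generalizing u w with
  | zero => exact h
  | succ n ih =>
    refine ih (fun t => ha1 _) (fun t => hb _) fun s hs => ?_
    have h1 : s * (1 - a (Fin.last n)) ∈ Set.Ici 0 := mul_nonneg hs (sub_nonneg.2 (ha1 _))
    have h2 : s * (1 + b (Fin.last n)) ∈ Set.Ici 0 :=
      mul_nonneg hs (add_nonneg zero_le_one (hb _))
    rw [twoPointMean, twoPointMean, h h1, h h2]

/-- Serves both `Z` (`w = 1`, `σ = √ν`) and `W T` (`w = T`). -/
lemma hasLaw_mul_sub_half {Ω : Type*} [MeasurableSpace Ω] {P : Measure Ω} {X : Ω → ℝ}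
    {w v : ℝ≥0} (hX : HasLaw X (gaussianReal 0 w) P) {σ : ℝ} (hσ : σ ^ 2 * w = v) :
    HasLaw (fun ω => σ * X ω - v / 2) (gaussianReal (-(v : ℝ) / 2) v) P := by
  have h := gaussianReal_sub_const (gaussianReal_const_mul hX σ) (v / 2)
  have hv : (.mk (σ ^ 2) (sq_nonneg _) * w : ℝ≥0) = v := NNReal.eq hσ
  rw [hv] at h
  convert h using 2
  ring

lemma HasLaw.integrable_comp_iff {Ω : Type*} [MeasurableSpace Ω] {P : Measure Ω} {X : Ω → ℝ}
    {μ : Measure ℝ} (hX : HasLaw X μ P) {f : ℝ → ℝ} (hf : Continuous f) :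
    Integrable (fun ω => f (X ω)) P ↔ Integrable f μ := by
  rw [← hX.map_eq, integrable_map_measure hf.aestronglyMeasurable hX.aemeasurable]
  rfl

end

/-! ### The limit theorem -/

theorem mainTheorem7
    (g : ℝ → ℝ) (L : ℝ≥0)
    (hg_lip : LipschitzOnWith L g (Set.Ici 0))
    (hg_conv : ConvexOn ℝ (Set.Ici 0) g)
    (S₀ : ℝ) (hS₀ : 0 < S₀)
    (ζlo ζhi : (τ : ℕ) → Fin τ → ℝ)
    (hlo : ∀ τ t, 0 ≤ ζlo τ t) (hhi : ∀ τ t, 0 ≤ ζhi τ t)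
    (ν : ℝ) (hν : 0 < ν)
    (hsum : Tendsto (fun τ : ℕ => ∑ t : Fin τ, ζlo τ t * ζhi τ t) atTop (𝓝 ν))
    (hsup : Tendsto (fun τ : ℕ => ⨆ t : Fin τ, max (ζlo τ t) (ζhi τ t)) atTop (𝓝 0)) :
    Integrable (fun z : ℝ => g (S₀ * Real.exp (√ν * z - ν / 2))) (gaussianReal 0 1) ∧
    Tendsto
      (fun τ : ℕ => europeanUpperBound g S₀ (fun t : Fin τ => Set.Icc (-ζlo τ t) (ζhi τ t)))
      atTop
      (𝓝 ((∫ z : ℝ, g (S₀ * Real.exp (√ν * z - ν / 2)) ∂(gaussianReal 0 1) : ℝ) : EReal)) ∧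
    -- the limit is the price `E[g(S_T)]` for a geometric Brownian motion `S` with zero drift
    ∀ (Ω : Type*) [MeasurableSpace Ω] (P : Measure Ω) [IsProbabilityMeasure P]
      (W : ℝ≥0 → Ω → ℝ), IsBrownianReal W P →
      ∀ (σ : ℝ) (T : ℝ≥0), 0 < σ → σ ^ 2 * T = ν →
        Integrable (fun ω => g (geometricBrownianMotion S₀ 0 σ W T ω)) P ∧
        ∫ ω, g (geometricBrownianMotion S₀ 0 σ W T ω) ∂P
          = ∫ z : ℝ, g (S₀ * Real.exp (√ν * z - ν / 2)) ∂(gaussianReal 0 1) := by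
  lift ν to ℝ≥0 using hν.le
  set G : ℝ → ℝ := fun x => g (max x 0) with hG
  have hGlip : LipschitzWith L G := hg_lip.lipschitzWith_comp_max
  have hGexp : ∀ y, g (S₀ * Real.exp y) = G (S₀ * Real.exp y) := fun y => by
    simp only [hG, max_eq_left (by positivity : 0 ≤ S₀ * Real.exp y)]
  have hcont : Continuous fun y => G (S₀ * Real.exp y) := by
    have := hGlip.continuous
    fun_prop
  set γ : Measure ℝ := gaussianReal (-(ν : ℝ) / 2) ν with hγ
  have hint : Integrable (fun y => G (S₀ * Real.exp y)) γ :=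
    hGlip.integrable_comp_exp hS₀.le (integrable_exp_mul_gaussianReal 2)
  have hZ : HasLaw (fun z : ℝ => √(ν : ℝ) * z - ν / 2) γ (gaussianReal 0 1) :=
    hasLaw_mul_sub_half HasLaw.id (by simp)
  have hZint := hZ.integral_comp hcont.aestronglyMeasurable
  simp only [Function.comp_def] at hZint
  simp only [hGexp]
  rw [hZint]
  refine ⟨(HasLaw.integrable_comp_iff hZ hcont).2 hint, ?_, ?_⟩
  · let μ : ℕ → ProbabilityMeasure ℝ := fun n =>
      ⟨logReturnLaw n (ζlo n) (ζhi n), isProbabilityMeasure_logReturnLaw (hlo n) (hhi n)⟩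
    have hμ : Tendsto μ atTop (𝓝 (⟨γ, inferInstance⟩ : ProbabilityMeasure ℝ)) :=
      ProbabilityMeasure.tendsto_iff_tendsto_charFun.2
        (tendsto_charFun_logReturnLaw hlo hhi hsum hsup)
    -- The identification of the game value with an integral needs this, so it holds only
    -- eventually.
    have hlt : ∀ᶠ n in atTop, ∀ t, ζlo n t < 1 := by
      filter_upwards [hsup.eventually (gt_mem_nhds one_pos)] with n hn t
      exact (le_iSup_max (ζlo n) (ζhi n) t).1.trans_lt hn
    have hB : ∀ᶠ n in atTop, ∫ y, Real.exp (2 * y) ∂(μ n : Measure ℝ) ≤ Real.exp (ν + 1) := by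
      filter_upwards [hlt, hsum.eventually (gt_mem_nhds (lt_add_one (ν : ℝ)))] with n h1 h2
      exact (integral_exp_two_mul_logReturnLaw_le (hlo n) h1 (hhi n)).trans
        (Real.exp_le_exp.2 h2.le)
    have hlim := tendsto_integral_comp_exp hGlip hS₀.le hμ
      (fun n => integrable_logReturnLaw _ _
        (by fun_prop : Measurable fun y : ℝ => Real.exp (2 * y)).stronglyMeasurable)
      (integrable_exp_mul_gaussianReal 2) hB
    refine (continuous_coe_real_ereal.tendsto _).comp hlim |>.congr' ?_
    filter_upwards [hlt] with n hn
    rw [europeanUpperBound_eq_binomialValue (hlo n) (fun t => (hn t).le) (hhi n) hg_conv hS₀.le,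
      binomialValue_congr (w := G) (fun t => (hn t).le) (hhi n)
        (fun x hx => by simp only [hG, max_eq_left (Set.mem_Ici.1 hx)]) hS₀.le,
      binomialValue_eq_integral (hlo n) hn (hhi n) hGlip.continuous.measurable]
    rfl
  · intro Ω _ P _ W hW σ T _ hσT
    -- Only the marginal of `W` at time `T` matters.
    have hX : HasLaw (fun ω => σ * W T ω - ν / 2) γ P :=
      hasLaw_mul_sub_half (hW.toIsPreBrownianReal.hasLaw_eval T) hσT
    have hS : (fun ω => g (geometricBrownianMotion S₀ 0 σ W T ω)) =
        fun ω => G (S₀ * Real.exp (σ * W T ω - ν / 2)) := by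
      funext ω
      rw [← hGexp, geometricBrownianMotion, ← hσT]
      ring_nf
    rw [hS]
    exact ⟨(HasLaw.integrable_comp_iff hX hcont).2 hint,
      hX.integral_comp hcont.aestronglyMeasurable⟩
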